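/- Let $(M,c)$ be a conformal manifold of dimension $d\ge 3$ (any signature), let $\sigma\in\Gamma\mathcal E[1]$ be a real conformal density of weight $1$, let $I_A=\frac1d D_A\sigma$ be its scale tractor, where $D_A$ is the Thomas-D operator, and suppose that $I^2=I^AI_A$ is nowhere zero. Let $I\cdot D=I^AD_A$ be the associated degenerate Laplacian; it maps sections of $\mathcal E^\Phi[w]$ to sections of $\mathcal E^\Phi[w-1]$ for every tractor bundle $\mathcal E^\Phi$ (a tensor part of a tensor power of the standard tractor bundle) and every weight $w\in\mathbb C$. Put $x=\sigma$ and $y=-\frac1{I^2}I\cdot D$, and for $K(z)=\sum_m\alpha_mz^m\in\mathbb C[[z]]$ let $:\!K(z)\!:\,f_0=\sum_m\alpha_m\,x^my^mf_0$ be the normal-ordered formal series. Call $:\!K\!:$ a *formal solution operator* on $\mathcal E^\Phi[w_0]$ if $K(0)=1$ and, for every smooth section $f_0$ of $\mathcal E^\Phi[w_0]$ and every $\ell\ge 0$, $$I\cdot D\Big(\sum_{m\le \ell}\alpha_m x^my^mf_0\Big)=O(\sigma^{\ell}),$$ that is, equals $\sigma^\ell$ times a smooth section. For $a\in\mathbb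 C$ write $(a)_m=a(a-1)\cdots(a-m+1)$, $(a)_0=1$. Let $w_0\in\mathbb C$ with $w_0\notin\{\frac{j-d}2: j\in\mathbb Z_{\ge2}\}$ and put $h_0=d+2w_0$. Then $(m+1-h_0)_m\neq0$ for all $m\ge 0$, and $$f_0\longmapsto\sum_{m=0}^\infty \sigma^m\,\frac{1}{m!\,(m+1-h_0)_m}\Big(\frac1{I^2}\,I\cdot D\Big)^{m}f_0$$ is a formal solution operator on $\mathcal E^\Phi[w_0]$, namely $:\!K\!:$ for $K(z)=\sum_m\frac{(-z)^m}{m!(m+1-h_0)_m}$. It is the only one, provided that some smooth section of $\mathcal E^\Phi[w_0]$ does not vanish identically along the zero locus $\Sigma=\{\sigma=0\}$ (that is, provided that $\Sigma\ne\emptyset$ and $\mathcal E^\Phi$ is not the zero bundle there). If $I^2$ is constant, the $m$-th term of the series equals $\sigma^m\frac{1}{m!\,(m+1-h_0)_m\,(I^2)^m}(I\cdot D)^mf_0$. For every $z\in\mathbb C\setminus\{0\}$ (principal branches) the series $K(z)$ converges and $$K(z)=z^{\frac{h_0-1}2}\,\Gamma(2-h_0)\,J_{1-h_0}(2\sqrt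 z),$$ where $J_\nu(u)=\sum_{m\ge0}\frac{(-1)^m}{m!\,\Gamma(m+\nu+1)}\left(\frac u2\right)^{2m+\nu}$. -/

import Mathlib

open scoped Manifold ContDiff Matrix

noncomputable section

namespace DegenerateLaplacian

/-! ### Calculus in one coordinate chart and one metric of the conformal class

Everything in this part takes place on (an open subset of) the coordinate space `ℝ^d`, for a metric
given by its matrix `G` of components.  Densities are trivialised by the metric, so that the
Levi-Civita connection on densities is the coordinate derivative of the trivialised density. -/

/-- Coordinate space. -/
abbrev Coord (d : ℕ) : Type := EuclideanSpace ℝ (Fin d)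

/-- The index set of the standard tractor bundle `𝓔[1] ⊕ T*M[1] ⊕ 𝓔[-1]`: a top slot,
`d` middle slots and a bottom slot. -/
abbrev TIdx (d : ℕ) : Type := Unit ⊕ (Fin d ⊕ Unit)

/-- Components of a (complex) tractor tensor of rank `k` at a point. -/
abbrev TTensor (d k : ℕ) : Type := (Fin k → TIdx d) → ℂ

/-- Components of a tractor tensor field of rank `k`, in coordinates and in a scale. -/
abbrev TField (d k : ℕ) : Type := Coord d → TTensor d k

variable {d k : ℕ}

/-- The `i`-th partial derivative. -/
def pd {V : Type*} [NormedAddCommGroup V] [NormedSpace ℝ V] (i : Fin d) (f : Coord d → V)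
    (x : Coord d) : V :=
  fderiv ℝ f x (EuclideanSpace.single i 1)

/-- Christoffel symbols `Γ^c_{ab}` of the Levi-Civita connection of `G`. -/
def christoffel (G : Coord d → Matrix (Fin d) (Fin d) ℝ) (x : Coord d) (c a b : Fin d) : ℝ :=
  (1 / 2) * ∑ e, (G x)⁻¹ c e *
    (pd a (fun y => G y b e) x + pd b (fun y => G y a e) x - pd e (fun y => G y a b) x)

/-- The Riemann curvature `R_{ab}{}^c{}_e`, with `R(X,Y)Z = X^a Y^b Z^e R_{ab}{}^c{}_e` and
`R(X,Y) = ∇_X ∇_Y - ∇_Y ∇_X - ∇_{[X,Y]}`. -/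
def riemann (G : Coord d → Matrix (Fin d) (Fin d) ℝ) (x : Coord d) (a b c e : Fin d) : ℝ :=
  pd a (fun y => christoffel G y c b e) x - pd b (fun y => christoffel G y c a e) x
    + ∑ m, (christoffel G x c a m * christoffel G x m b e
      - christoffel G x c b m * christoffel G x m a e)

/-- The Ricci tensor `Ric_{ab} = R_{ca}{}^c{}_b`. -/
def ricci (G : Coord d → Matrix (Fin d) (Fin d) ℝ) (x : Coord d) (a b : Fin d) : ℝ :=
  ∑ c, riemann G x c a c b

/-- `J = Sc / (2(d-1))`, the trace of the Schouten tensor. -/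
def schoutenTrace (G : Coord d → Matrix (Fin d) (Fin d) ℝ) (x : Coord d) : ℝ :=
  (∑ a, ∑ b, (G x)⁻¹ a b * ricci G x a b) / (2 * ((d : ℝ) - 1))

/-- The Schouten tensor: `Ric_{ab} = (d-2) P_{ab} + J g_{ab}`. -/
def schouten (G : Coord d → Matrix (Fin d) (Fin d) ℝ) (x : Coord d) (a b : Fin d) : ℝ :=
  (ricci G x a b - schoutenTrace G x * G x a b) / ((d : ℝ) - 2)

/-- The tractor metric `h(T,T) = g^{ab} μ_a μ_b + 2 σ ρ` of `T = (σ, μ_a, ρ)`, as a matrix. -/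
def tractorMetric (G : Matrix (Fin d) (Fin d) ℝ) : Matrix (TIdx d) (TIdx d) ℝ
  | .inl _, .inr (.inr _) => 1
  | .inr (.inr _), .inl _ => 1
  | .inr (.inl a), .inr (.inl b) => G⁻¹ a b
  | _, _ => 0

/-- The matrix `A_a` of the (coupled Levi-Civita-)tractor connection in coordinates,
`∇_a T = ∂_a T + A_a T`, where for `T = (σ, μ_b, ρ)`
`∇_a T = (∇_a σ - μ_a, ∇_a μ_b + g_{ab} ρ + P_{ab} σ, ∇_a ρ - P_{ac} μ^c)`. -/
def tractorConn (G : Coord d → Matrix (Fin d) (Fin d) ℝ) (x : Coord d) (a : Fin d) :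
    Matrix (TIdx d) (TIdx d) ℝ
  | .inl _, .inr (.inl b) => if a = b then -1 else 0
  | .inr (.inl b), .inl _ => schouten G x a b
  | .inr (.inl b), .inr (.inl c) => -christoffel G x c a b
  | .inr (.inl b), .inr (.inr _) => G x a b
  | .inr (.inr _), .inr (.inl b) => -∑ c, schouten G x a c * (G x)⁻¹ c b
  | _, _ => 0

/-- The action of an endomorphism of the standard tractor space on rank `k` tensors by
derivations (sum over the slots). -/
def derivationAct (A : Matrix (TIdx d) (TIdx d) ℝ) (T : TTensor d k) : TTensor d k :=
  fun B => ∑ r, ∑ C, (A (B r) C : ℂ) * T (Function.update B r C)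

/-- The action of a linear map of the standard tractor space on rank `k` tensors
(its `k`-th tensor power). -/
def tensorPowerAct (S : Matrix (TIdx d) (TIdx d) ℝ) (T : TTensor d k) : TTensor d k :=
  fun B => ∑ C : Fin k → TIdx d, (∏ r, (S (B r) (C r) : ℂ)) * T C

/-- The coupled covariant derivative `∇_a f` of a weighted tractor tensor field. -/
def nabla (G : Coord d → Matrix (Fin d) (Fin d) ℝ) (a : Fin d) (f : TField d k) : TField d k :=
  fun x => pd a f x + derivationAct (tractorConn G x a) (f x)

/-- The coupled Laplacian `Δ f = g^{ab} ∇_a ∇_b f`. -/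
def laplacian (G : Coord d → Matrix (Fin d) (Fin d) ℝ) (f : TField d k) : TField d k :=
  fun x => ∑ a, ∑ b, (((G x)⁻¹ a b : ℝ) : ℂ) •
    (nabla G a (nabla G b f) x - ∑ c, ((christoffel G x c a b : ℝ) : ℂ) • nabla G c f x)

/-- The Thomas-D operator `D_A f` on tractor tensors of weight `w`, whose slots are
`((d+2w-2) w f, (d+2w-2) ∇_a f, -(Δ f + J w f))`. -/
def thomasD (G : Coord d → Matrix (Fin d) (Fin d) ℝ) (w : ℂ) (f : TField d k) (x : Coord d) :
    TIdx d → TTensor d k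
  | .inl _ => ((d + 2 * w - 2) * w) • f x
  | .inr (.inl a) => (d + 2 * w - 2) • nabla G a f x
  | .inr (.inr _) => -(laplacian G f x + ((schoutenTrace G x : ℂ) * w) • f x)

/-- The scale tractor `I_A = (1/d) D_A σ` of a density `σ` of weight `1`. -/
def scaleTractor (G : Coord d → Matrix (Fin d) (Fin d) ℝ) (s : Coord d → ℝ) (x : Coord d) :
    TIdx d → ℂ :=
  fun A => (1 / (d : ℂ)) * thomasD (k := 0) G 1 (fun y _ => (s y : ℂ)) x A Fin.elim0

/-- `I² = I^A I_A`. -/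
def scaleSq (G : Coord d → Matrix (Fin d) (Fin d) ℝ) (s : Coord d → ℝ) (x : Coord d) : ℂ :=
  ∑ A, ∑ B, (tractorMetric (G x) A B : ℂ) * scaleTractor G s x A * scaleTractor G s x B

/-- The degenerate Laplacian `I·D = I^A D_A` on tractor tensors of weight `w`. -/
def IdotD (G : Coord d → Matrix (Fin d) (Fin d) ℝ) (s : Coord d → ℝ) (w : ℂ) (f : TField d k) :
    TField d k :=
  fun x => ∑ A, ∑ B, ((tractorMetric (G x) A B : ℂ) * scaleTractor G s x A) • thomasD G w f x B

/-- The operator `(1/I²) I·D` on weight `w`. -/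
def normIdotD (G : Coord d → Matrix (Fin d) (Fin d) ℝ) (s : Coord d → ℝ) (w : ℂ)
    (f : TField d k) : TField d k :=
  fun x => (1 / scaleSq G s x) • IdotD G s w f x

/-- The `𝔰𝔩(2)` generator `y = -(1/I²) I·D` on weight `w`. -/
def yOp (G : Coord d → Matrix (Fin d) (Fin d) ℝ) (s : Coord d → ℝ) (w : ℂ)
    (f : TField d k) : TField d k :=
  fun x => -(1 / scaleSq G s x) • IdotD G s w f x

/-- The `m`-th power, starting on weight `w`, of an operator that lowers the weight by one. -/
def wpow (P : ℂ → TField d k → TField d k) (w : ℂ) : ℕ → TField d k → TField d k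
  | 0, f => f
  | m + 1, f => P (w - m) (wpow P w m f)

/-- The terms of order at most `ℓ` of the normal ordered series
`:K(z): f₀ = ∑ α_m x^m y^m f₀`, where `x = σ` and `K = ∑ α_m z^m`. -/
def normalOrdered (G : Coord d → Matrix (Fin d) (Fin d) ℝ) (s : Coord d → ℝ) (w : ℂ)
    (K : PowerSeries ℂ) (ℓ : ℕ) (f : TField d k) : TField d k :=
  fun x => ∑ m ∈ Finset.range (ℓ + 1),
    (PowerSeries.coeff m K * (s x : ℂ) ^ m) • wpow (yOp G s) w m f x

/-! ### Conformal manifolds, scales and weighted tractor bundles -/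

variable {M : Type*} [TopologicalSpace M] [ChartedSpace (Coord d) M]

/-- The components of a field of bilinear forms in the coordinates of a chart. -/
def gram (g : ∀ p : M, LinearMap.BilinForm ℝ (TangentSpace (𝓡 d) p))
    (φ : OpenPartialHomeomorph M (Coord d)) (x : Coord d) : Matrix (Fin d) (Fin d) ℝ :=
  Matrix.of fun i j => g (φ.symm x)
    (mfderiv (𝓡 d) (𝓡 d) φ.symm x (EuclideanSpace.single i (1 : ℝ) : Coord d))
    (mfderiv (𝓡 d) (𝓡 d) φ.symm x (EuclideanSpace.single j (1 : ℝ) : Coord d))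

variable (d M) in
/-- A smooth pseudo-Riemannian metric. -/
structure PseudoMetric where
  form : ∀ p : M, LinearMap.BilinForm ℝ (TangentSpace (𝓡 d) p)
  symm : ∀ p v w, form p v w = form p w v
  nondegenerate : ∀ p v, (∀ w, form p v w = 0) → v = 0
  smooth : ∀ φ ∈ IsManifold.maximalAtlas (𝓡 d) ∞ M, ∀ i j,
    ContDiffOn ℝ ∞ (fun x => gram form φ x i j) φ.target

/-- `g' = e^{2Υ} g` with `Υ` smooth. -/
structure ConformallyRelated (g g' : PseudoMetric d M) (Υ : M → ℝ) : Prop where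
  smooth : ContMDiff (𝓡 d) 𝓘(ℝ, ℝ) ∞ Υ
  eq : ∀ p v w, g'.form p v w = Real.exp (2 * Υ p) * g.form p v w

variable (d M) in
/-- A conformal structure: a conformal equivalence class of metrics. -/
structure ConformalStructure where
  metrics : Set (PseudoMetric d M)
  nonempty : metrics.Nonempty
  mem_iff : ∀ g ∈ metrics, ∀ g', g' ∈ metrics ↔ ∃ Υ, ConformallyRelated g g' Υ

/-- A smooth real section of `𝓔[1]`, through its representatives in the trivialisations given by
the metrics `g` of the conformal class. -/
structure RealScale (C : ConformalStructure d M) where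
  val : PseudoMetric d M → M → ℝ
  smooth : ∀ g ∈ C.metrics, ContMDiff (𝓡 d) 𝓘(ℝ, ℝ) ∞ (val g)
  conformal : ∀ g ∈ C.metrics, ∀ g' ∈ C.metrics, ∀ Υ, ConformallyRelated g g' Υ →
    ∀ p, val g' p = Real.exp (Υ p) * val g p

/-- A scale in the coordinates of a chart. -/
def RealScale.inChart {C : ConformalStructure d M} (σ : RealScale C) (g : PseudoMetric d M)
    (φ : OpenPartialHomeomorph M (Coord d)) : Coord d → ℝ :=
  fun x => σ.val g (φ.symm x)

/-- The change of the components `(σ, μ_a, ρ)` of a standard tractor at `p` from the chart `φ` and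
the metric `g` to the chart `ψ` and the metric `e^{2Υ} g`.  Invariantly, `(σ, μ, ρ)` becomes
`(σ, μ_b + σ Υ_b, ρ - g^{cd} Υ_c μ_d - ½ σ g^{cd} Υ_c Υ_d)`, and the slots, of weight `1, 1, -1`,
are moreover multiplied by `e^Υ, e^Υ, e^{-Υ}`; the middle slot is a one-form. -/
def tractorTransition (g : PseudoMetric d M) (Υ : M → ℝ) (φ ψ : OpenPartialHomeomorph M (Coord d))
    (p : M) : Matrix (TIdx d) (TIdx d) ℝ :=
  let jac : Fin d → Fin d → ℝ := fun b a => pd b (fun y => φ (ψ.symm y)) (ψ p) a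
  let dΥ : Fin d → ℝ := fun a => pd a (fun y => Υ (φ.symm y)) (φ p)
  let ginv : Matrix (Fin d) (Fin d) ℝ := (gram g.form φ (φ p))⁻¹
  fun A B => match A, B with
  | .inl _, .inl _ => Real.exp (Υ p)
  | .inr (.inl b), .inl _ => Real.exp (Υ p) * ∑ a, jac b a * dΥ a
  | .inr (.inl b), .inr (.inl a) => Real.exp (Υ p) * jac b a
  | .inr (.inr _), .inl _ => -Real.exp (-Υ p) * ((1 / 2) * ∑ a, ∑ c, ginv a c * dΥ a * dΥ c)
  | .inr (.inr _), .inr (.inl a) => -Real.exp (-Υ p) * ∑ c, ginv c a * dΥ c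
  | .inr (.inr _), .inr (.inr _) => Real.exp (-Υ p)
  | _, _ => 0

variable (d k) in
/-- A tensor part of the `k`-th tensor power of a space with a nondegenerate symmetric form `h`:
a subspace assigned naturally to `h`, that is, compatibly with all linear isomorphisms.
Equivalently, a subrepresentation, for the orthogonal group of `h`, of the `k`-th tensor power. -/
structure TensorPart where
  space : Matrix (TIdx d) (TIdx d) ℝ → Submodule ℂ (TTensor d k)
  natural : ∀ h : Matrix (TIdx d) (TIdx d) ℝ, h.IsSymm → IsUnit h.det →
    ∀ S : Matrix (TIdx d) (TIdx d) ℝ, IsUnit S.det →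
    ∀ T : TTensor d k, T ∈ space (Sᵀ * h * S) ↔ tensorPowerAct S T ∈ space h

/-- A smooth section of the weighted tractor bundle `𝓔^Φ[w]`, where `𝓔^Φ` is the tensor part `Φ` of
the `k`-th tensor power of the standard tractor bundle: components for every metric of the conformal
class and every chart, related by the change of components of tractors and the factor `e^{wΥ}`. -/
structure TractorSection (C : ConformalStructure d M) (Φ : TensorPart d k) (w : ℂ) where
  comp : PseudoMetric d M → OpenPartialHomeomorph M (Coord d) → TField d k
  smooth : ∀ g ∈ C.metrics, ∀ φ ∈ IsManifold.maximalAtlas (𝓡 d) ∞ M,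
    ContDiffOn ℝ ∞ (comp g φ) φ.target
  mem : ∀ g ∈ C.metrics, ∀ φ ∈ IsManifold.maximalAtlas (𝓡 d) ∞ M, ∀ x ∈ φ.target,
    comp g φ x ∈ Φ.space (tractorMetric (gram g.form φ x))
  transform : ∀ g ∈ C.metrics, ∀ g' ∈ C.metrics, ∀ Υ, ConformallyRelated g g' Υ →
    ∀ φ ∈ IsManifold.maximalAtlas (𝓡 d) ∞ M, ∀ ψ ∈ IsManifold.maximalAtlas (𝓡 d) ∞ M,
    ∀ p ∈ φ.source ∩ ψ.source,
      comp g' ψ (ψ p) = Complex.exp (w * Υ p) •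
        tensorPowerAct (tractorTransition g Υ φ ψ p) (comp g φ (φ p))

/-- `I²` is nowhere zero. -/
def ScaleSqNowhereZero {C : ConformalStructure d M} (σ : RealScale C) : Prop :=
  ∀ g ∈ C.metrics, ∀ φ ∈ IsManifold.maximalAtlas (𝓡 d) ∞ M, ∀ x ∈ φ.target,
    scaleSq (gram g.form φ) (σ.inChart g φ) x ≠ 0

/-- The section `u` does not vanish identically along the zero locus of `σ`. -/
def TractorSection.NonzeroAlong {C : ConformalStructure d M} {Φ : TensorPart d k} {w : ℂ}
    (u : TractorSection C Φ w) (σ : RealScale C) : Prop :=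
  ∃ g ∈ C.metrics, ∃ φ ∈ IsManifold.maximalAtlas (𝓡 d) ∞ M, ∃ p ∈ φ.source,
    σ.val g p = 0 ∧ u.comp g φ (φ p) ≠ 0

/-- `:K(z): f₀` solves `I·D f = 0` formally: for every `ℓ`, its terms of order at most `ℓ`
solve `I·D f = O(σ^ℓ)`. -/
def IsFormalSolution {C : ConformalStructure d M} (σ : RealScale C) {Φ : TensorPart d k} {w : ℂ}
    (K : PowerSeries ℂ) (f₀ : TractorSection C Φ w) : Prop :=
  ∀ ℓ : ℕ, ∀ g ∈ C.metrics, ∀ φ ∈ IsManifold.maximalAtlas (𝓡 d) ∞ M,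
    ∃ r : TField d k, ContDiffOn ℝ ∞ r φ.target ∧ ∀ x ∈ φ.target,
      IdotD (gram g.form φ) (σ.inChart g φ) w
          (normalOrdered (gram g.form φ) (σ.inChart g φ) w K ℓ (f₀.comp g φ)) x
        = ((σ.inChart g φ x : ℂ) ^ ℓ) • r x

/-- `:K:` is a formal solution operator on `𝓔^Φ[w]`: `K = 1 + α₁ z + α₂ z² + ⋯`, and `:K(z): f₀`
formally solves `I·D f = 0` for every section `f₀`. -/
def IsFormalSolutionOperator {C : ConformalStructure d M} (σ : RealScale C) (Φ : TensorPart d k)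
    (w : ℂ) (K : PowerSeries ℂ) : Prop :=
  PowerSeries.constantCoeff K = 1 ∧ ∀ f₀ : TractorSection C Φ w, IsFormalSolution σ K f₀

/-! ### The Bessel series -/

/-- The Pochhammer symbol `(a)_m = a (a-1) ⋯ (a-m+1)`. -/
def pochhammer (a : ℂ) (m : ℕ) : ℂ := ∏ j ∈ Finset.range m, (a - j)

/-- The Bessel function of the first kind, with principal branch of `u ^ ν`. -/
def besselJ (ν u : ℂ) : ℂ :=
  (u / 2) ^ ν * ∑' m : ℕ, (-1) ^ m / ((m.factorial : ℂ) * Complex.Gamma (m + ν + 1)) *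
    (u / 2) ^ (2 * m)

end DegenerateLaplacian

end

/-! In a fixed chart and metric everything rests on one commutator: on weight `w`, `[I·D, σ] = (d +
2w) I²`. It needs only the Leibniz rule for the connection, the symmetry of the metric and the
formula `I² = 2σρ + |dσ|²`, with `ρ` the bottom slot of `I`; no curvature identity enters. Iteration
(`IdotD_scale_pow_smul`) gives `[I·D, σ^{m+1}] = (m+1)(d + 2w + m) σ^m I²`.

Existence: `y^{m+1} f₀` has weight `w₀ - m - 1`, so `I·D (σ^{m+1} y^{m+1} f₀)` is `σ^{m+1} I·D
y^{m+1} f₀ + (m+1)(h₀ - m - 2) σ^m I² y^{m+1} f₀`. Since `I² y^{m+1} f₀ = -I·D y^m f₀`, the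
truncated series telescopes to its last remainder when `α_{m+1} (m+1)(h₀ - m - 2) = α_m`. As `h₀` is
none of 2, 3, ..., this recursion with `α_0 = 1` has a unique solution, `solutionCoeff`.

Uniqueness: the recursion is also necessary (`coeff_recursion`). For `u` nonzero at a point `p` of
`Σ`, the test section `σ^{m+1} u` has `y^{m+1} (σ^{m+1} u) = c u` along `Σ` with `c ≠ 0`, again
because `h₀` is not an integer at least 2. Any defect in the recursion would then leave a term of
exact order `σ^m` near `p`; it can be detected because `I² ≠ 0` forces `dσ ≠ 0` on `Σ`.

The Bessel form follows from `Γ(m+2-h₀) = Γ(2-h₀) (m+1-h₀)_m`. -/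

noncomputable section

namespace DegenerateLaplacian

open Filter Topology

variable {d k : ℕ}

/-! ### Leibniz rules and the commutator of `I·D` with `σ` -/

section Leibniz

variable {G : Coord d → Matrix (Fin d) (Fin d) ℝ} {s : Coord d → ℝ} {w : ℂ}

theorem pd_smul {V : Type*} [NormedAddCommGroup V] [NormedSpace ℝ V] [NormedSpace ℂ V]
    [IsScalarTower ℝ ℂ V] {φ : Coord d → ℂ} {f : Coord d → V} {x : Coord d}
    (hφ : DifferentiableAt ℝ φ x) (hf : DifferentiableAt ℝ f x) (a : Fin d) :
    pd a (fun y => φ y • f y) x = pd a φ x • f x + φ x • pd a f x := by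
  unfold pd
  rw [fderiv_fun_smul hφ hf]
  simp [add_comm]

theorem pd_add {V : Type*} [NormedAddCommGroup V] [NormedSpace ℝ V]
    {f g : Coord d → V} {x : Coord d}
    (hf : DifferentiableAt ℝ f x) (hg : DifferentiableAt ℝ g x) (a : Fin d) :
    pd a (fun y => f y + g y) x = pd a f x + pd a g x := by
  unfold pd
  rw [fderiv_fun_add hf hg]
  simp

theorem pd_eventuallyEq {V : Type*} [NormedAddCommGroup V] [NormedSpace ℝ V]
    {f g : Coord d → V} {x : Coord d} (h : f =ᶠ[𝓝 x] g) (a : Fin d) :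
    pd a f =ᶠ[𝓝 x] pd a g := by
  filter_upwards [h.fderiv (𝕜 := ℝ)] with y hy
  simp only [pd, hy]

theorem contDiffOn_pd {V : Type*} [NormedAddCommGroup V] [NormedSpace ℝ V]
    {f : Coord d → V} {U : Set (Coord d)} (hU : IsOpen U) (hf : ContDiffOn ℝ ∞ f U) (a : Fin d) :
    ContDiffOn ℝ ∞ (pd a f) U :=
  (hf.fderiv_of_isOpen hU (m := ∞) (by simp)).clm_apply contDiffOn_const

theorem derivationAct_smul (A : Matrix (TIdx d) (TIdx d) ℝ) (c : ℂ) (T : TTensor d k) :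
    derivationAct A (c • T) = c • derivationAct A T := by
  ext B
  simp only [derivationAct, Pi.smul_apply, smul_eq_mul, Finset.mul_sum]
  exact Finset.sum_congr rfl fun _ _ => Finset.sum_congr rfl fun _ _ => by ring

theorem derivationAct_add (A : Matrix (TIdx d) (TIdx d) ℝ) (S T : TTensor d k) :
    derivationAct A (S + T) = derivationAct A S + derivationAct A T := by
  ext B
  simp only [derivationAct, Pi.add_apply, mul_add, Finset.sum_add_distrib]

theorem nabla_smul {φ : Coord d → ℂ} {f : TField d k} {x : Coord d}
    (hφ : DifferentiableAt ℝ φ x) (hf : DifferentiableAt ℝ f x) (a : Fin d) :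
    nabla G a (fun y => φ y • f y) x = pd a φ x • f x + φ x • nabla G a f x := by
  simp only [nabla, pd_smul hφ hf, derivationAct_smul, smul_add, add_assoc]

theorem nabla_add {f g : TField d k} {x : Coord d}
    (hf : DifferentiableAt ℝ f x) (hg : DifferentiableAt ℝ g x) (a : Fin d) :
    nabla G a (fun y => f y + g y) x = nabla G a f x + nabla G a g x := by
  simp only [nabla, pd_add hf hg, derivationAct_add]
  abel

theorem nabla_eventuallyEq {f g : TField d k} {x : Coord d} (h : f =ᶠ[𝓝 x] g) (a : Fin d) :
    nabla G a f =ᶠ[𝓝 x] nabla G a g := by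
  filter_upwards [h, pd_eventuallyEq h a] with y hy hy'
  simp only [nabla, hy, hy']

theorem laplacian_congr {f g : TField d k} {x : Coord d} (h : f =ᶠ[𝓝 x] g) :
    laplacian G f x = laplacian G g x := by
  have h1 : ∀ a, nabla G a f x = nabla G a g x := fun a => (nabla_eventuallyEq h a).eq_of_nhds
  have h2 : ∀ a b, nabla G a (nabla G b f) x = nabla G a (nabla G b g) x := fun a b =>
    (nabla_eventuallyEq (nabla_eventuallyEq h b) a).eq_of_nhds
  simp only [laplacian, h1, h2]

/-- A differential operator sees only germs. This matters because identities between fields hold on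
the chart target only, and have to be differentiated there. -/
theorem IdotD_congr {f g : TField d k} {x : Coord d} (h : f =ᶠ[𝓝 x] g) :
    IdotD G s w f x = IdotD G s w g x := by
  have h1 : ∀ a, nabla G a f x = nabla G a g x := fun a => (nabla_eventuallyEq h a).eq_of_nhds
  have : thomasD G w f x = thomasD G w g x := by
    funext A
    rcases A with _ | _ | _ <;> simp only [thomasD, h.eq_of_nhds, h1, laplacian_congr h]
  simp only [IdotD, this]

/-- The Laplacian of functions. -/
def scalarLaplacian (G : Coord d → Matrix (Fin d) (Fin d) ℝ) (φ : Coord d → ℂ) (x : Coord d) : ℂ :=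
  ∑ a, ∑ b, (((G x)⁻¹ a b : ℝ) : ℂ) *
    (pd a (pd b φ) x - ∑ c, ((christoffel G x c a b : ℝ) : ℂ) * pd c φ x)

/-- The gradient pairing `g^{ab} (∂_a φ) (∇_b f)`. -/
def gradPairing (G : Coord d → Matrix (Fin d) (Fin d) ℝ) (φ : Coord d → ℂ) (f : TField d k) :
    TField d k :=
  fun x => ∑ a, ∑ b, ((((G x)⁻¹ a b : ℝ) : ℂ) * pd a φ x) • nabla G b f x

theorem laplacian_smul {φ : Coord d → ℂ} {f : TField d k} {U : Set (Coord d)} (hU : IsOpen U)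
    (hφ : ContDiffOn ℝ ∞ φ U) (hf : ContDiffOn ℝ ∞ f U)
    (hn : ∀ a, ContDiffOn ℝ ∞ (nabla G a f) U) {x : Coord d} (hx : x ∈ U) (hG : (G x).IsSymm) :
    laplacian G (fun y => φ y • f y) x = scalarLaplacian G φ x • f x
      + (2 : ℂ) • gradPairing G φ f x + φ x • laplacian G f x := by
  have dφ : ∀ y ∈ U, DifferentiableAt ℝ φ y := fun y hy =>
    (hφ.differentiableOn (by simp)).differentiableAt (hU.mem_nhds hy)
  have df : ∀ y ∈ U, DifferentiableAt ℝ f y := fun y hy =>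
    (hf.differentiableOn (by simp)).differentiableAt (hU.mem_nhds hy)
  have dn : ∀ a, DifferentiableAt ℝ (nabla G a f) x := fun a =>
    ((hn a).differentiableOn (by simp)).differentiableAt (hU.mem_nhds hx)
  have dp : ∀ a, DifferentiableAt ℝ (pd a φ) x := fun a =>
    ((contDiffOn_pd hU hφ a).differentiableOn (by simp)).differentiableAt (hU.mem_nhds hx)
  have key : ∀ a b, nabla G a (nabla G b (fun y => φ y • f y)) x =
      pd a (pd b φ) x • f x + pd b φ x • nabla G a f x + pd a φ x • nabla G b f x
        + φ x • nabla G a (nabla G b f) x := by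
    intro a b
    have e : nabla G b (fun y => φ y • f y) =ᶠ[𝓝 x]
        fun y => pd b φ y • f y + φ y • nabla G b f y := by
      filter_upwards [hU.mem_nhds hx] with y hy
      exact nabla_smul (dφ y hy) (df y hy) b
    rw [(nabla_eventuallyEq e a).eq_of_nhds,
      nabla_add (f := fun y => pd b φ y • f y) (g := fun y => φ y • nabla G b f y)
        ((dp b).smul (df x hx)) ((dφ x hx).smul (dn b)),
      nabla_smul (dp b) (df x hx), nabla_smul (dφ x hx) (dn b)]
    abel
  have hGi : ∀ a b, (G x)⁻¹ a b = (G x)⁻¹ b a := fun a b => by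
    have h : ((G x)⁻¹).IsSymm := by
      rw [Matrix.IsSymm, Matrix.transpose_nonsing_inv, hG.eq]
    exact h.apply b a
  have comm : (∑ a, ∑ b, ((((G x)⁻¹ a b : ℝ) : ℂ) * pd b φ x) • nabla G a f x)
      = gradPairing G φ f x := by
    rw [Finset.sum_comm, gradPairing]
    exact Finset.sum_congr rfl fun a _ => Finset.sum_congr rfl fun b _ => by rw [hGi]
  -- The two cross terms differ by exchanging `a` and `b`; one copy of the pairing is written with
  -- the indices exchanged so that the sums agree term by term.
  rw [two_smul]
  nth_rewrite 1 [← comm]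
  simp only [laplacian, scalarLaplacian, gradPairing, Finset.sum_smul, Finset.smul_sum,
    ← Finset.sum_add_distrib]
  refine Finset.sum_congr rfl fun a _ => Finset.sum_congr rfl fun b _ => ?_
  simp only [key, nabla_smul (dφ x hx) (df x hx), smul_add, smul_sub, Finset.sum_add_distrib,
    sub_smul, mul_sub, mul_smul, Finset.sum_smul, Finset.mul_sum, Finset.smul_sum]
  have : ∀ c, ((christoffel G x c a b : ℝ) : ℂ) • φ x • nabla G c f x =
    φ x • ((christoffel G x c a b : ℝ) : ℂ) • nabla G c f x := fun c => smul_comm _ _ _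
  simp only [this, smul_comm _ (φ x)]
  abel

/-- The bottom slot of the scale tractor. -/
def scaleBottom (G : Coord d → Matrix (Fin d) (Fin d) ℝ) (s : Coord d → ℝ) (x : Coord d) : ℂ :=
  -(1 / (d : ℂ)) * (scalarLaplacian G (fun y => (s y : ℂ)) x + schoutenTrace G x * s x)

theorem pd_apply {φ : Coord d → ℂ} {x : Coord d} (hφ : DifferentiableAt ℝ φ x) (a : Fin d)
    (B : Fin 0 → TIdx d) : pd a (fun y (_ : Fin 0 → TIdx d) => φ y) x B = pd a φ x := by
  unfold pd
  rw [fderiv_pi fun _ => hφ]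
  rfl

theorem nabla_rank_zero {φ : Coord d → ℂ} {x : Coord d} (hφ : DifferentiableAt ℝ φ x) (a : Fin d) :
    nabla (k := 0) G a (fun y _ => φ y) x = fun _ => pd a φ x := by
  ext B
  simp [nabla, derivationAct, pd_apply hφ]

theorem laplacian_rank_zero {φ : Coord d → ℂ} {U : Set (Coord d)} (hU : IsOpen U)
    (hφ : ContDiffOn ℝ ∞ φ U) {x : Coord d} (hx : x ∈ U) (B : Fin 0 → TIdx d) :
    laplacian (k := 0) G (fun y _ => φ y) x B = scalarLaplacian G φ x := by
  have dφ : ∀ y ∈ U, DifferentiableAt ℝ φ y := fun y hy =>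
    (hφ.differentiableOn (by simp)).differentiableAt (hU.mem_nhds hy)
  have dp : ∀ a, DifferentiableAt ℝ (pd a φ) x := fun a =>
    ((contDiffOn_pd hU hφ a).differentiableOn (by simp)).differentiableAt (hU.mem_nhds hx)
  have key : ∀ a b, nabla (k := 0) G a (nabla G b fun y _ => φ y) x =
      fun _ => pd a (pd b φ) x := by
    intro a b
    have e : nabla (k := 0) G b (fun y _ => φ y) =ᶠ[𝓝 x] fun y _ => pd b φ y := by
      filter_upwards [hU.mem_nhds hx] with y hy
      exact nabla_rank_zero (dφ y hy) b
    rw [(nabla_eventuallyEq e a).eq_of_nhds, nabla_rank_zero (dp b)]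
  simp [laplacian, scalarLaplacian, key, nabla_rank_zero (dφ x hx), Finset.sum_apply]

theorem contDiffOn_ofReal {U : Set (Coord d)} (hs : ContDiffOn ℝ ∞ s U) :
    ContDiffOn ℝ ∞ (fun y => (s y : ℂ)) U :=
  Complex.ofRealCLM.contDiff.comp_contDiffOn hs

theorem scaleTractor_top (hd : d ≠ 0) (x : Coord d) (u : Unit) :
    scaleTractor G s x (.inl u) = s x := by
  have : (d : ℂ) ≠ 0 := by exact_mod_cast hd
  simp [scaleTractor, thomasD]
  field_simp

theorem scaleTractor_middle (hd : d ≠ 0) {U : Set (Coord d)} (hU : IsOpen U)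
    (hs : ContDiffOn ℝ ∞ s U) {x : Coord d} (hx : x ∈ U) (a : Fin d) :
    scaleTractor G s x (.inr (.inl a)) = pd a (fun y => (s y : ℂ)) x := by
  have : (d : ℂ) ≠ 0 := by exact_mod_cast hd
  have dφ : DifferentiableAt ℝ (fun y => (s y : ℂ)) x :=
    ((contDiffOn_ofReal hs).differentiableOn (by simp)).differentiableAt (hU.mem_nhds hx)
  simp [scaleTractor, thomasD, nabla_rank_zero dφ]
  field_simp

theorem scaleTractor_bottom {U : Set (Coord d)} (hU : IsOpen U)
    (hs : ContDiffOn ℝ ∞ s U) {x : Coord d} (hx : x ∈ U) (u : Unit) :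
    scaleTractor G s x (.inr (.inr u)) = scaleBottom G s x := by
  simp [scaleTractor, thomasD, laplacian_rank_zero hU (contDiffOn_ofReal hs) hx, scaleBottom]
  ring

theorem scaleSq_eq (hd : d ≠ 0) {U : Set (Coord d)} (hU : IsOpen U)
    (hs : ContDiffOn ℝ ∞ s U) {x : Coord d} (hx : x ∈ U) :
    scaleSq G s x = 2 * s x * scaleBottom G s x + ∑ a, ∑ b, (((G x)⁻¹ a b : ℝ) : ℂ) *
      pd a (fun y => (s y : ℂ)) x * pd b (fun y => (s y : ℂ)) x := by
  simp [scaleSq, Fintype.sum_sum_type, scaleTractor_top hd, scaleTractor_middle hd hU hs hx,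
    scaleTractor_bottom hU hs hx, tractorMetric]
  ring

/-- The tractor metric pairs top with bottom slots, so `σ` multiplies the second order slot of `D`,
and `ρ` its zeroth order slot. -/
theorem IdotD_eq (hd : d ≠ 0) {U : Set (Coord d)} (hU : IsOpen U)
    (hs : ContDiffOn ℝ ∞ s U) {x : Coord d} (hx : x ∈ U) (f : TField d k) :
    IdotD G s w f x = -((s x : ℂ) • (laplacian G f x + ((schoutenTrace G x : ℂ) * w) • f x))
      + (d + 2 * w - 2) • gradPairing G (fun y => (s y : ℂ)) f x
      + (scaleBottom G s x * ((d + 2 * w - 2) * w)) • f x := by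
  simp [IdotD, Fintype.sum_sum_type, scaleTractor_top hd, scaleTractor_middle hd hU hs hx,
    scaleTractor_bottom hU hs hx, tractorMetric, thomasD, gradPairing, Finset.smul_sum, smul_smul]
  simp only [mul_comm, mul_left_comm]
  abel

theorem gradPairing_smul {φ ψ : Coord d → ℂ} {f : TField d k} {x : Coord d}
    (hψ : DifferentiableAt ℝ ψ x) (hf : DifferentiableAt ℝ f x) :
    gradPairing G φ (fun y => ψ y • f y) x =
      (∑ a, ∑ b, (((G x)⁻¹ a b : ℝ) : ℂ) * pd a φ x * pd b ψ x) • f x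
        + ψ x • gradPairing G φ f x := by
  simp only [gradPairing, nabla_smul hψ hf, smul_add, Finset.sum_add_distrib, Finset.sum_smul,
    Finset.smul_sum, smul_smul]
  congr 1
  exact Finset.sum_congr rfl fun _ _ => Finset.sum_congr rfl fun _ _ => by congr 1; ring

/-- The `𝔰𝔩(2)` commutator `[I·D, σ] = I² (d + 2w)`. -/
theorem IdotD_scale_smul (hd : d ≠ 0) {U : Set (Coord d)} (hU : IsOpen U)
    (hs : ContDiffOn ℝ ∞ s U) {f : TField d k} (hf : ContDiffOn ℝ ∞ f U)
    (hn : ∀ a, ContDiffOn ℝ ∞ (nabla G a f) U) {x : Coord d} (hx : x ∈ U) (hG : (G x).IsSymm) :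
    IdotD G s (w + 1) (fun y => (s y : ℂ) • f y) x =
      (s x : ℂ) • IdotD G s w f x + ((d + 2 * w) * scaleSq G s x) • f x := by
  have hd' : (d : ℂ) ≠ 0 := by exact_mod_cast hd
  have dφ : DifferentiableAt ℝ (fun y => (s y : ℂ)) x :=
    ((contDiffOn_ofReal hs).differentiableOn (by simp)).differentiableAt (hU.mem_nhds hx)
  have df : DifferentiableAt ℝ f x :=
    (hf.differentiableOn (by simp)).differentiableAt (hU.mem_nhds hx)
  -- With `Δσ` expressed through `ρ`, both sides are combinations of `Δf`, the gradient pairing and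
  -- `f`, and the claim is a polynomial identity in the coefficients.
  have hL : scalarLaplacian G (fun y => (s y : ℂ)) x =
      -(d * scaleBottom G s x) - schoutenTrace G x * s x := by
    rw [scaleBottom]; field_simp; ring
  rw [IdotD_eq hd hU hs hx, IdotD_eq hd hU hs hx, scaleSq_eq hd hU hs hx,
    laplacian_smul hU (contDiffOn_ofReal hs) hf hn hx hG, gradPairing_smul dφ df, hL]
  module

end Leibniz

/-! ### Smoothness of curvature, connection and `I·D` in a chart -/

section Smoothness

variable {d k : ℕ} {G : Coord d → Matrix (Fin d) (Fin d) ℝ} {s : Coord d → ℝ} {w : ℂ}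
  {U : Set (Coord d)}

/-- `G` is the matrix of components of a smooth pseudo-Riemannian metric on the open set `U`. -/
structure IsMetricOn (G : Coord d → Matrix (Fin d) (Fin d) ℝ) (U : Set (Coord d)) : Prop where
  isOpen : IsOpen U
  smooth : ∀ i j, ContDiffOn ℝ ∞ (fun x => G x i j) U
  isSymm : ∀ x ∈ U, (G x).IsSymm
  det_ne_zero : ∀ x ∈ U, (G x).det ≠ 0

theorem contDiffOn_det {n : ℕ} {A : Coord d → Matrix (Fin n) (Fin n) ℝ}
    (hA : ∀ i j, ContDiffOn ℝ ∞ (fun x => A x i j) U) :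
    ContDiffOn ℝ ∞ (fun x => (A x).det) U := by
  simp only [Matrix.det_apply']
  exact ContDiffOn.sum fun σ _ => contDiffOn_const.mul (contDiffOn_prod fun i _ => hA _ _)

namespace IsMetricOn

theorem contDiffOn_inv (hG : IsMetricOn G U) (a b : Fin d) :
    ContDiffOn ℝ ∞ (fun x => (G x)⁻¹ a b) U := by
  -- Cramer's rule exhibits the entries of the inverse as quotients of determinants.
  have h : ∀ x, (G x)⁻¹ a b = ((G x).det)⁻¹ * ((G x).updateRow b (Pi.single a 1)).det := fun x => by
    rw [Matrix.inv_def, Ring.inverse_eq_inv', Matrix.smul_apply, Matrix.adjugate_apply, smul_eq_mul]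
  simp only [h]
  refine ((contDiffOn_det hG.smooth).inv hG.det_ne_zero).mul (contDiffOn_det fun i j => ?_)
  by_cases hi : i = b
  · subst hi
    simpa using contDiffOn_const
  · simpa [Matrix.updateRow_ne hi] using hG.smooth i j

theorem contDiffOn_christoffel (hG : IsMetricOn G U) (c a b : Fin d) :
    ContDiffOn ℝ ∞ (fun x => christoffel G x c a b) U :=
  contDiffOn_const.mul (ContDiffOn.sum fun e _ => (hG.contDiffOn_inv c e).mul
    (((contDiffOn_pd hG.isOpen (hG.smooth b e) a).add
      (contDiffOn_pd hG.isOpen (hG.smooth a e) b)).sub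
        (contDiffOn_pd hG.isOpen (hG.smooth a b) e)))

theorem contDiffOn_riemann (hG : IsMetricOn G U) (a b c e : Fin d) :
    ContDiffOn ℝ ∞ (fun x => riemann G x a b c e) U :=
  ((contDiffOn_pd hG.isOpen (hG.contDiffOn_christoffel c b e) a).sub
    (contDiffOn_pd hG.isOpen (hG.contDiffOn_christoffel c a e) b)).add
      (ContDiffOn.sum fun m _ =>
        ((hG.contDiffOn_christoffel c a m).mul (hG.contDiffOn_christoffel m b e)).sub
          ((hG.contDiffOn_christoffel c b m).mul (hG.contDiffOn_christoffel m a e)))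

theorem contDiffOn_ricci (hG : IsMetricOn G U) (a b : Fin d) :
    ContDiffOn ℝ ∞ (fun x => ricci G x a b) U :=
  ContDiffOn.sum fun c _ => hG.contDiffOn_riemann c a c b

theorem contDiffOn_schoutenTrace (hG : IsMetricOn G U) :
    ContDiffOn ℝ ∞ (fun x => schoutenTrace G x) U :=
  (ContDiffOn.sum fun a _ => ContDiffOn.sum fun b _ =>
    (hG.contDiffOn_inv a b).mul (hG.contDiffOn_ricci a b)).div_const _

theorem contDiffOn_schouten (hG : IsMetricOn G U) (a b : Fin d) :
    ContDiffOn ℝ ∞ (fun x => schouten G x a b) U :=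
  ((hG.contDiffOn_ricci a b).sub (hG.contDiffOn_schoutenTrace.mul (hG.smooth a b))).div_const _

theorem contDiffOn_tractorConn (hG : IsMetricOn G U) (a : Fin d) (A B : TIdx d) :
    ContDiffOn ℝ ∞ (fun x => tractorConn G x a A B) U := by
  rcases A with _ | b | _ <;> rcases B with _ | c | _ <;> simp only [tractorConn]
  all_goals first
    | exact contDiffOn_const
    | exact hG.contDiffOn_schouten _ _
    | exact (hG.contDiffOn_christoffel _ _ _).neg
    | exact hG.smooth _ _
    | exact (ContDiffOn.sum fun e _ => (hG.contDiffOn_schouten _ _).mul (hG.contDiffOn_inv _ _)).neg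

theorem contDiffOn_nabla (hG : IsMetricOn G U) (a : Fin d) {f : TField d k}
    (hf : ContDiffOn ℝ ∞ f U) : ContDiffOn ℝ ∞ (nabla G a f) U := by
  refine (contDiffOn_pd hG.isOpen hf a).add (contDiffOn_pi.2 fun B => ?_)
  exact ContDiffOn.sum fun r _ => ContDiffOn.sum fun A _ =>
    (contDiffOn_ofReal (hG.contDiffOn_tractorConn a _ _)).mul (contDiffOn_pi.1 hf _)

theorem contDiffOn_laplacian (hG : IsMetricOn G U) {f : TField d k}
    (hf : ContDiffOn ℝ ∞ f U) : ContDiffOn ℝ ∞ (laplacian G f) U :=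
  ContDiffOn.sum fun a _ => ContDiffOn.sum fun b _ =>
    (contDiffOn_ofReal (hG.contDiffOn_inv a b)).smul
      ((hG.contDiffOn_nabla a (hG.contDiffOn_nabla b hf)).sub (ContDiffOn.sum fun c _ =>
        (contDiffOn_ofReal (hG.contDiffOn_christoffel c a b)).smul (hG.contDiffOn_nabla c hf)))

theorem contDiffOn_thomasD (hG : IsMetricOn G U) {f : TField d k}
    (hf : ContDiffOn ℝ ∞ f U) (A : TIdx d) : ContDiffOn ℝ ∞ (fun x => thomasD G w f x A) U := by
  rcases A with _ | a | _
  · exact hf.const_smul ((d + 2 * w - 2) * w)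
  · exact (hG.contDiffOn_nabla a hf).const_smul (d + 2 * w - 2)
  · exact ((hG.contDiffOn_laplacian hf).add
      (((contDiffOn_ofReal hG.contDiffOn_schoutenTrace).mul contDiffOn_const).smul hf)).neg

theorem contDiffOn_tractorMetric (hG : IsMetricOn G U) (A B : TIdx d) :
    ContDiffOn ℝ ∞ (fun x => tractorMetric (G x) A B) U := by
  rcases A with _ | b | _ <;> rcases B with _ | c | _ <;> simp only [tractorMetric]
  all_goals first
    | exact contDiffOn_const
    | exact hG.contDiffOn_inv _ _

theorem contDiffOn_scaleTractor (hG : IsMetricOn G U) (hs : ContDiffOn ℝ ∞ s U) (A : TIdx d) :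
    ContDiffOn ℝ ∞ (fun x => scaleTractor G s x A) U :=
  contDiffOn_const.mul (contDiffOn_pi.1 (hG.contDiffOn_thomasD (k := 0)
    (contDiffOn_pi.2 fun _ => contDiffOn_ofReal hs) A) _)

theorem contDiffOn_scaleSq (hG : IsMetricOn G U) (hs : ContDiffOn ℝ ∞ s U) :
    ContDiffOn ℝ ∞ (scaleSq G s) U :=
  ContDiffOn.sum fun A _ => ContDiffOn.sum fun B _ =>
    ((contDiffOn_ofReal (hG.contDiffOn_tractorMetric A B)).mul
      (hG.contDiffOn_scaleTractor hs A)).mul (hG.contDiffOn_scaleTractor hs B)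

theorem contDiffOn_IdotD (hG : IsMetricOn G U) (hs : ContDiffOn ℝ ∞ s U) {f : TField d k}
    (hf : ContDiffOn ℝ ∞ f U) : ContDiffOn ℝ ∞ (IdotD G s w f) U :=
  ContDiffOn.sum fun A _ => ContDiffOn.sum fun B _ =>
    ((contDiffOn_ofReal (hG.contDiffOn_tractorMetric A B)).mul
      (hG.contDiffOn_scaleTractor hs A)).smul (hG.contDiffOn_thomasD hf B)

theorem contDiffOn_yOp (hG : IsMetricOn G U) (hs : ContDiffOn ℝ ∞ s U)
    (hI : ∀ x ∈ U, scaleSq G s x ≠ 0) {f : TField d k}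
    (hf : ContDiffOn ℝ ∞ f U) : ContDiffOn ℝ ∞ (yOp G s w f) U := by
  have h := ((hG.contDiffOn_scaleSq hs).inv hI).neg.smul (hG.contDiffOn_IdotD (w := w) hs hf)
  exact h.congr fun x _ => by simp [yOp]

theorem contDiffOn_wpow_yOp (hG : IsMetricOn G U) (hs : ContDiffOn ℝ ∞ s U)
    (hI : ∀ x ∈ U, scaleSq G s x ≠ 0) {f : TField d k}
    (hf : ContDiffOn ℝ ∞ f U) (m : ℕ) : ContDiffOn ℝ ∞ (wpow (yOp G s) w m f) U := by
  induction m with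
  | zero => exact hf
  | succ m ih => exact hG.contDiffOn_yOp hs hI ih

end IsMetricOn

end Smoothness

/-! ### The recursion: sufficiency and necessity -/

section FormalSolutions

variable {d k : ℕ} {G : Coord d → Matrix (Fin d) (Fin d) ℝ} {s : Coord d → ℝ} {w : ℂ}
  {U : Set (Coord d)}

theorem contDiffOn_differentiableAt {V : Type*} [NormedAddCommGroup V] [NormedSpace ℝ V]
    {f : Coord d → V} (hU : IsOpen U) (hf : ContDiffOn ℝ ∞ f U) {x : Coord d} (hx : x ∈ U) :
    DifferentiableAt ℝ f x :=
  (hf.differentiableOn (by simp)).differentiableAt (hU.mem_nhds hx)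

theorem pd_const {V : Type*} [NormedAddCommGroup V] [NormedSpace ℝ V] (a : Fin d) (c : V) :
    pd a (fun _ : Coord d => c) = fun _ => 0 := by
  funext x
  simp [pd]

namespace IsMetricOn

theorem laplacian_add (hG : IsMetricOn G U) {f g : TField d k}
    (hf : ContDiffOn ℝ ∞ f U) (hg : ContDiffOn ℝ ∞ g U) {x : Coord d} (hx : x ∈ U) :
    laplacian G (fun y => f y + g y) x = laplacian G f x + laplacian G g x := by
  have hU := hG.isOpen
  have h1 : ∀ a, ∀ y ∈ U, nabla G a (fun y => f y + g y) y = nabla G a f y + nabla G a g y :=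
    fun a y hy =>
      nabla_add (contDiffOn_differentiableAt hU hf hy) (contDiffOn_differentiableAt hU hg hy) a
  have h2 : ∀ a b, nabla G a (nabla G b (fun y => f y + g y)) x =
      nabla G a (nabla G b f) x + nabla G a (nabla G b g) x := by
    intro a b
    have e : nabla G b (fun y => f y + g y) =ᶠ[𝓝 x] fun y => nabla G b f y + nabla G b g y := by
      filter_upwards [hU.mem_nhds hx] with y hy using h1 b y hy
    rw [(nabla_eventuallyEq e a).eq_of_nhds,
      nabla_add (contDiffOn_differentiableAt hU (hG.contDiffOn_nabla b hf) hx)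
        (contDiffOn_differentiableAt hU (hG.contDiffOn_nabla b hg) hx)]
  simp only [laplacian, h2, h1 _ x hx, ← Finset.sum_add_distrib]
  refine Finset.sum_congr rfl fun a _ => Finset.sum_congr rfl fun b _ => ?_
  rw [← smul_add]
  congr 1
  simp only [smul_add, Finset.sum_add_distrib]
  abel

theorem IdotD_add (hG : IsMetricOn G U) {f g : TField d k}
    (hf : ContDiffOn ℝ ∞ f U) (hg : ContDiffOn ℝ ∞ g U) {x : Coord d} (hx : x ∈ U) :
    IdotD G s w (fun y => f y + g y) x = IdotD G s w f x + IdotD G s w g x := by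
  have hU := hG.isOpen
  have h : ∀ A, thomasD G w (fun y => f y + g y) x A = thomasD G w f x A + thomasD G w g x A := by
    rintro (_ | a | _)
    · simp only [thomasD, smul_add]
    · simp only [thomasD, ← smul_add, nabla_add (contDiffOn_differentiableAt hU hf hx)
        (contDiffOn_differentiableAt hU hg hx)]
    · simp only [thomasD, smul_add, hG.laplacian_add hf hg hx]
      abel
  simp only [IdotD, h, smul_add, Finset.sum_add_distrib]

theorem IdotD_const_smul (hG : IsMetricOn G U) (c : ℂ) {f : TField d k}
    (hf : ContDiffOn ℝ ∞ f U) {x : Coord d} (hx : x ∈ U) :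
    IdotD G s w (fun y => c • f y) x = c • IdotD G s w f x := by
  have hU := hG.isOpen
  have h0 : ∀ y ∈ U, ∀ a, nabla G a (fun y => c • f y) y = c • nabla G a f y := by
    intro y hy a
    rw [nabla_smul (φ := fun _ => c) (differentiableAt_const c)
      (contDiffOn_differentiableAt hU hf hy), pd_const, zero_smul, zero_add]
  have hl : laplacian G (fun y => c • f y) x = c • laplacian G f x := by
    rw [laplacian_smul (φ := fun _ => c) hU contDiffOn_const hf
      (fun a => hG.contDiffOn_nabla a hf) hx (hG.isSymm x hx)]
    simp [scalarLaplacian, gradPairing, pd_const]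
  have h : ∀ A, thomasD G w (fun y => c • f y) x A = c • thomasD G w f x A := by
    rintro (_ | a | _)
    · simp only [thomasD, smul_comm c]
    · simp only [thomasD, h0 x hx, smul_comm c]
    · simp only [thomasD, hl, smul_comm c, smul_add, smul_neg]
  simp only [IdotD, h, smul_comm c, Finset.smul_sum]

/-- The `𝔰𝔩(2)` commutator `[I·D, σ^{n+1}] = I² σ^n (n+1) (d + 2w + n)`. -/
theorem IdotD_scale_pow_smul (hG : IsMetricOn G U) (hd : d ≠ 0) (hs : ContDiffOn ℝ ∞ s U)
    {f : TField d k} (hf : ContDiffOn ℝ ∞ f U) (n : ℕ) {x : Coord d} (hx : x ∈ U) :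
    IdotD G s (w + (n + 1)) (fun y => (s y : ℂ) ^ (n + 1) • f y) x =
      (s x : ℂ) ^ (n + 1) • IdotD G s w f x
        + ((n + 1) * (d + 2 * w + n) * (s x : ℂ) ^ n * scaleSq G s x) • f x := by
  have hS := contDiffOn_ofReal hs
  have step : ∀ {w : ℂ} {f : TField d k}, ContDiffOn ℝ ∞ f U →
      IdotD G s (w + 1) (fun y => (s y : ℂ) • f y) x =
      (s x : ℂ) • IdotD G s w f x + ((d + 2 * w) * scaleSq G s x) • f x := fun hf =>
    IdotD_scale_smul hd hG.isOpen hs hf (fun a => hG.contDiffOn_nabla a hf) hx (hG.isSymm x hx)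
  induction n with
  | zero =>
    simp only [zero_add, pow_one, Nat.cast_zero, step hf, pow_zero]
    module
  | succ n ih =>
    have e : (fun y => (s y : ℂ) ^ (n + 1 + 1) • f y) =
        fun y => (s y : ℂ) • ((s y : ℂ) ^ (n + 1) • f y) := by
      funext y
      rw [smul_smul, pow_succ' _ (n + 1)]
    have ew : w + (((n + 1 : ℕ) : ℂ) + 1) = w + (n + 1) + 1 := by push_cast; ring
    -- The outer factor `σ` acts on weight `w + n + 1` and contributes `d + 2w + 2n + 2`, which
    -- turns `(n+1)(d+2w+n)` into `(n+2)(d+2w+n+1)`.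
    rw [e, ew, step (f := fun y => (s y : ℂ) ^ (n + 1) • f y) ((hS.pow _).smul hf), ih]
    push_cast
    module

theorem contDiffOn_normalOrdered (hG : IsMetricOn G U) (hs : ContDiffOn ℝ ∞ s U)
    (hI : ∀ x ∈ U, scaleSq G s x ≠ 0) {f : TField d k} (hf : ContDiffOn ℝ ∞ f U)
    (K : PowerSeries ℂ) (ℓ : ℕ) : ContDiffOn ℝ ∞ (normalOrdered G s w K ℓ f) U :=
  ContDiffOn.sum fun m _ => (contDiffOn_const.mul ((contDiffOn_ofReal hs).pow m)).smul
    (hG.contDiffOn_wpow_yOp hs hI hf m)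

/-- The commutator is applied on the weight `w - (ℓ+1)` of `y^{ℓ+1} f`. No recursion is assumed, so
the formula serves both existence and uniqueness. -/
theorem IdotD_normalOrdered_succ (hG : IsMetricOn G U) (hd : d ≠ 0) (hs : ContDiffOn ℝ ∞ s U)
    (hI : ∀ x ∈ U, scaleSq G s x ≠ 0) {f : TField d k} (hf : ContDiffOn ℝ ∞ f U)
    (K : PowerSeries ℂ) (ℓ : ℕ) {x : Coord d} (hx : x ∈ U) :
    IdotD G s w (normalOrdered G s w K (ℓ + 1) f) x = IdotD G s w (normalOrdered G s w K ℓ f) x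
      + (PowerSeries.coeff (ℓ + 1) K * (s x : ℂ) ^ (ℓ + 1)) •
          IdotD G s (w - (ℓ + 1 : ℕ)) (wpow (yOp G s) w (ℓ + 1) f) x
      + (PowerSeries.coeff (ℓ + 1) K * ((ℓ + 1) * (d + 2 * w - ℓ - 2)) * (s x : ℂ) ^ ℓ *
          scaleSq G s x) • wpow (yOp G s) w (ℓ + 1) f x := by
  have hy := hG.contDiffOn_wpow_yOp (w := w) hs hI hf (ℓ + 1)
  have hsy : ContDiffOn ℝ ∞ (fun y => (s y : ℂ) ^ (ℓ + 1) • wpow (yOp G s) w (ℓ + 1) f y) U :=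
    ((contDiffOn_ofReal hs).pow _).smul hy
  have e : normalOrdered G s w K (ℓ + 1) f = fun y => normalOrdered G s w K ℓ f y +
      PowerSeries.coeff (ℓ + 1) K • ((s y : ℂ) ^ (ℓ + 1) • wpow (yOp G s) w (ℓ + 1) f y) := by
    funext y
    simp only [normalOrdered, Finset.sum_range_succ _ (ℓ + 1), smul_smul]
  have hp := hG.IdotD_scale_pow_smul (w := w - (ℓ + 1 : ℕ)) hd hs hy ℓ hx
  rw [show w - ((ℓ + 1 : ℕ) : ℂ) + (ℓ + 1) = w by push_cast; ring] at hp
  rw [e, hG.IdotD_add (hG.contDiffOn_normalOrdered hs hI hf K ℓ) (hsy.const_smul _) hx,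
    hG.IdotD_const_smul _ hsy hx, hp]
  push_cast
  module

theorem scaleSq_smul_yOp (hI : ∀ x ∈ U, scaleSq G s x ≠ 0) (f : TField d k)
    {x : Coord d} (hx : x ∈ U) : scaleSq G s x • yOp G s w f x = -IdotD G s w f x := by
  rw [yOp, smul_smul, mul_neg, mul_one_div_cancel (hI x hx), neg_one_smul]

/-- If the coefficients of `K` satisfy the recursion below order `ℓ`, only the term of order `σ^ℓ`
remains in `I·D` of the truncated series. -/
theorem IdotD_normalOrdered (hG : IsMetricOn G U) (hd : d ≠ 0) (hs : ContDiffOn ℝ ∞ s U)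
    (hI : ∀ x ∈ U, scaleSq G s x ≠ 0) {f : TField d k} (hf : ContDiffOn ℝ ∞ f U)
    (K : PowerSeries ℂ) (ℓ : ℕ)
    (hK : ∀ m < ℓ, PowerSeries.coeff (m + 1) K * ((m + 1) * (d + 2 * w - m - 2)) =
      PowerSeries.coeff m K) {x : Coord d} (hx : x ∈ U) :
    IdotD G s w (normalOrdered G s w K ℓ f) x =
      (PowerSeries.coeff ℓ K * (s x : ℂ) ^ ℓ) • IdotD G s (w - ℓ) (wpow (yOp G s) w ℓ f) x := by
  induction ℓ with
  | zero =>
    have e : normalOrdered G s w K 0 f = fun y => PowerSeries.coeff 0 K • f y := by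
      funext y
      simp [normalOrdered, wpow]
    rw [e, hG.IdotD_const_smul _ hf hx]
    simp [wpow]
  | succ ℓ ih =>
    -- The new term of order `σ^ℓ` is `-α_ℓ σ^ℓ I·D y^ℓ f`, which cancels the remainder of the
    -- previous truncation.
    rw [hG.IdotD_normalOrdered_succ hd hs hI hf K ℓ hx, ih fun m hm => hK m (by omega),
      hK ℓ (by omega), mul_smul _ (scaleSq G s x), wpow, scaleSq_smul_yOp hI _ hx]
    push_cast
    module

/-- A constant factor `b` commutes with `I·D`. The cases used are `b = -1`, for `(1/I²) I·D`, and `b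
= -I²` when `I²` is constant, for `I·D` itself. -/
theorem wpow_eq_smul_wpow_yOp (hG : IsMetricOn G U) (hs : ContDiffOn ℝ ∞ s U)
    (hI : ∀ x ∈ U, scaleSq G s x ≠ 0) {P : ℂ → TField d k → TField d k} {b : ℂ}
    (hP : ∀ w f, ∀ x ∈ U, P w f x = b • yOp G s w f x)
    {f : TField d k} (hf : ContDiffOn ℝ ∞ f U) (m : ℕ) {x : Coord d} (hx : x ∈ U) :
    wpow P w m f x = b ^ m • wpow (yOp G s) w m f x := by
  induction m generalizing x with
  | zero => simp [wpow]
  | succ m ih =>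
    have e : wpow P w m f =ᶠ[𝓝 x] fun y => b ^ m • wpow (yOp G s) w m f y := by
      filter_upwards [hG.isOpen.mem_nhds hx] with y hy using ih hy
    rw [wpow, hP _ _ x hx, wpow, yOp, yOp, IdotD_congr e,
      hG.IdotD_const_smul _ (hG.contDiffOn_wpow_yOp hs hI hf m) hx]
    module

/-- Up to higher order in `σ`, `y^j` maps `σ^{j+i} u` to a nonzero multiple of `σ^i u`. -/
theorem wpow_yOp_scale_pow_smul (hG : IsMetricOn G U) (hd : d ≠ 0) (hs : ContDiffOn ℝ ∞ s U)
    (hI : ∀ x ∈ U, scaleSq G s x ≠ 0) (hw : ∀ j : ℕ, 2 ≤ j → (d + 2 * w : ℂ) ≠ j)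
    {u : TField d k} (hu : ContDiffOn ℝ ∞ u U) (j i : ℕ) :
    ∃ g : TField d k, ContDiffOn ℝ ∞ g U ∧
      (∀ x ∈ U, wpow (yOp G s) w j (fun y => (s y : ℂ) ^ (j + i) • u y) x = (s x : ℂ) ^ i • g x) ∧
      ∃ c : ℂ, c ≠ 0 ∧ ∀ x ∈ U, s x = 0 → g x = c • u x := by
  induction j generalizing i with
  | zero => exact ⟨u, hu, fun x _ => by simp [wpow], 1, one_ne_zero, fun x _ _ => by simp⟩
  | succ j ih =>
    obtain ⟨g, hg, hgx, c, hc, hcx⟩ := ih (i + 1)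
    have hne : (d + 2 * w - (2 * j + i + 2) : ℂ) ≠ 0 := by
      have h := hw (2 * j + i + 2) (by omega)
      push_cast at h
      exact sub_ne_zero.2 h
    -- This is `y (σ^{i+1} g)` divided by `σ^i`, with `g` of weight `w - j - (i+1)`; the first
    -- summand vanishes on `Σ`, so the constant acquires only the commutator factor.
    refine ⟨fun x => (s x : ℂ) • yOp G s (w - j - (i + 1)) g x
        + (-((i + 1) * (d + 2 * w - (2 * j + i + 2)))) • g x,
      ((contDiffOn_ofReal hs).smul (hG.contDiffOn_yOp hs hI hg)).add (hg.const_smul _),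
      fun x hx => ?_, -((i + 1) * (d + 2 * w - (2 * j + i + 2))) * c,
      mul_ne_zero (neg_ne_zero.2 (mul_ne_zero (by exact_mod_cast i.succ_ne_zero) hne)) hc,
      fun x hx hx0 => ?_⟩
    · have e : wpow (yOp G s) w j (fun y => (s y : ℂ) ^ (j + 1 + i) • u y) =ᶠ[𝓝 x]
          fun y => (s y : ℂ) ^ (i + 1) • g y := by
        filter_upwards [hG.isOpen.mem_nhds hx] with y hy
        rw [← hgx y hy]
        simp only [add_assoc, add_comm 1 i]
      have hp := hG.IdotD_scale_pow_smul (w := w - j - (i + 1)) hd hs hg i hx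
      rw [sub_add_cancel] at hp
      rw [wpow, yOp, IdotD_congr e, hp]
      simp only [yOp]
      have := hI x hx
      match_scalars <;> field_simp <;> ring
    · simp only [hx0, Complex.ofReal_zero, zero_smul, zero_add, hcx x hx hx0, smul_smul]

end IsMetricOn

/-- Where `σ = 0`, `I²` reduces to `|dσ|²`. -/
theorem exists_pd_ne_zero (hd : d ≠ 0) (hU : IsOpen U) (hs : ContDiffOn ℝ ∞ s U) {x : Coord d}
    (hx : x ∈ U) (hx0 : s x = 0) (hI : scaleSq G s x ≠ 0) : ∃ a, pd a s x ≠ 0 := by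
  by_contra! h
  apply hI
  have h' : ∀ a, pd a (fun y => (s y : ℂ)) x = 0 := by
    intro a
    have hd := (contDiffOn_differentiableAt hU hs hx).hasFDerivAt
    have := (Complex.ofRealCLM.hasFDerivAt.comp x hd).fderiv
    have h2 := h a
    unfold pd at h2 ⊢
    rw [show (fun y => (s y : ℂ)) = Complex.ofRealCLM ∘ s from rfl, this]
    simp [h2]
  rw [scaleSq_eq hd hU hs hx]
  simp [hx0, h']

/-- Powers of a defining function can be cancelled. -/
theorem eq_zero_of_scale_pow_smul_eq {V : Type*} [NormedAddCommGroup V] [NormedSpace ℂ V]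
    (hU : IsOpen U) {F H : Coord d → V} (hs : ContDiffOn ℝ ∞ s U) (hF : ContinuousOn F U)
    (hH : ContinuousOn H U) {n : ℕ}
    (h : ∀ x ∈ U, (s x : ℂ) ^ n • F x = (s x : ℂ) ^ (n + 1) • H x) {p : Coord d} (hp : p ∈ U)
    (hp0 : s p = 0) {a : Fin d} (ha : pd a s p ≠ 0) : F p = 0 := by
  -- Along a line through `p` transverse to the zero locus, `s` is nonzero near `p` except at `p`.
  -- There `s^n` cancels, and continuity carries `F = s H` to `p`.
  let γ : ℝ → Coord d := fun t => p + t • EuclideanSpace.single a (1 : ℝ)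
  have hγ : HasDerivAt γ (EuclideanSpace.single a (1 : ℝ)) 0 := by
    have h := ((hasDerivAt_id (0 : ℝ)).smul_const (EuclideanSpace.single a (1 : ℝ))).const_add p
    rwa [one_smul] at h
  have hγ0 : γ 0 = p := by simp [γ]
  have hsγ : HasDerivAt (s ∘ γ) (pd a s p) 0 := by
    have hd := (contDiffOn_differentiableAt hU hs hp).hasFDerivAt
    rw [← hγ0] at hd
    have := hd.comp_hasDerivAt 0 hγ
    rwa [hγ0] at this
  have hne : ∀ᶠ t in 𝓝[≠] (0 : ℝ), s (γ t) ≠ 0 := hsγ.eventually_ne ha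
  have hcγ : Tendsto γ (𝓝[≠] 0) (𝓝 p) := by
    have := hγ.continuousAt.tendsto
    rw [hγ0] at this
    exact this.mono_left nhdsWithin_le_nhds
  have hc : ContinuousAt (fun x => F x - (s x : ℂ) • H x) p :=
    ((hF.sub ((contDiffOn_ofReal hs).continuousOn.smul hH)).continuousAt (hU.mem_nhds hp))
  have hlim := hc.tendsto.comp hcγ
  have hz : (fun x => F x - (s x : ℂ) • H x) ∘ γ =ᶠ[𝓝[≠] 0] fun _ => 0 := by
    filter_upwards [hne, hcγ.eventually (hU.mem_nhds hp)] with t ht htU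
    have h1 := h (γ t) htU
    have hsn : (s (γ t) : ℂ) ^ n ≠ 0 := pow_ne_zero _ (by exact_mod_cast ht)
    rw [pow_succ, mul_smul] at h1
    exact sub_eq_zero.2 (smul_right_injective V hsn h1)
  have := tendsto_nhds_unique (hlim.congr' hz) tendsto_const_nhds
  simpa [hp0] using this

/-- The recursion for the coefficients is necessary. -/
theorem IsMetricOn.coeff_recursion (hG : IsMetricOn G U) (hd : d ≠ 0) (hs : ContDiffOn ℝ ∞ s U)
    (hI : ∀ x ∈ U, scaleSq G s x ≠ 0) (hw : ∀ j : ℕ, 2 ≤ j → (d + 2 * w : ℂ) ≠ j)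
    (K : PowerSeries ℂ) {u : TField d k} (hu : ContDiffOn ℝ ∞ u U) {p : Coord d} (hp : p ∈ U)
    (hp0 : s p = 0) (hup : u p ≠ 0)
    (hK : ∀ n : ℕ, ∃ r : TField d k, ContDiffOn ℝ ∞ r U ∧ ∀ x ∈ U,
      IdotD G s w (normalOrdered G s w K n (fun y => (s y : ℂ) ^ n • u y)) x =
        (s x : ℂ) ^ n • r x) (m : ℕ) :
    PowerSeries.coeff (m + 1) K * ((m + 1) * (d + 2 * w - m - 2)) = PowerSeries.coeff m K := by
  induction m using Nat.strong_induction_on with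
  | _ m ih =>
    obtain ⟨r, hr, hrx⟩ := hK (m + 1)
    set v : TField d k := fun y => (s y : ℂ) ^ (m + 1) • u y with hv
    have hvs : ContDiffOn ℝ ∞ v U := ((contDiffOn_ofReal hs).pow _).smul hu
    -- With `i = 0` no power of `σ` is left over, so `y^{m+1} v` equals `c u` at `p`.
    obtain ⟨g, -, hgx, c, hc, hcx⟩ := hG.wpow_yOp_scale_pow_smul hd hs hI hw hu (m + 1) 0
    have hY := hG.contDiffOn_wpow_yOp (w := w) hs hI hvs (m + 1)
    have hYp : wpow (yOp G s) w (m + 1) v p ≠ 0 := by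
      have := hgx p hp
      rw [add_zero, pow_zero, one_smul, hcx p hp hp0] at this
      rw [this]
      exact smul_ne_zero hc hup
    obtain ⟨a, ha⟩ := exists_pd_ne_zero hd hG.isOpen hs hp hp0 (hI p hp)
    -- The defect of the recursion. By the induction hypothesis the lower orders telescope, leaving
    -- `δ σ^m I² y^{m+1} v` modulo `σ^{m+1}`.
    set δ := PowerSeries.coeff (m + 1) K * ((m + 1) * (d + 2 * w - m - 2)) -
      PowerSeries.coeff m K with hδ
    have hzero := eq_zero_of_scale_pow_smul_eq (n := m) hG.isOpen
      (F := fun x => (δ * scaleSq G s x) • wpow (yOp G s) w (m + 1) v x)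
      (H := fun x => r x - PowerSeries.coeff (m + 1) K •
        IdotD G s (w - (m + 1 : ℕ)) (wpow (yOp G s) w (m + 1) v) x) hs
      ((contDiffOn_const.mul (hG.contDiffOn_scaleSq hs)).smul hY).continuousOn
      (hr.sub ((hG.contDiffOn_IdotD hs hY).const_smul _)).continuousOn ?_ hp hp0 ha
    · have := (smul_eq_zero.1 hzero).resolve_right hYp
      exact sub_eq_zero.1 ((mul_eq_zero.1 this).resolve_right (hI p hp))
    · intro x hx
      have h1 := hrx x hx
      have h2 := IsMetricOn.scaleSq_smul_yOp (w := w - m) hI (wpow (yOp G s) w m v) hx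
      rw [hG.IdotD_normalOrdered_succ hd hs hI hvs K m hx,
        hG.IdotD_normalOrdered hd hs hI hvs K m ih hx,
        ← neg_neg (IdotD G s (w - m) _ x), ← h2] at h1
      rw [smul_sub, ← h1, hδ, wpow]
      module

end FormalSolutions

/-! ### The coefficients, convergence and the Bessel function -/

section Bessel

/-- The coefficients `(-1)^m / (m! (m+1-h)_m)`. -/
def solutionCoeff (h : ℂ) (m : ℕ) : ℂ :=
  (-1) ^ m / ((m.factorial : ℂ) * pochhammer (m + 1 - h) m)

variable {h : ℂ}

/-- Here `(m+1-h)_m = (2-h)(3-h)⋯(m+1-h)`, so a step of `m` appends a single factor although the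
base moves too. -/
theorem pochhammer_shift_succ (h : ℂ) (m : ℕ) :
    pochhammer ((m + 1 : ℕ) + 1 - h) (m + 1) = pochhammer (m + 1 - h) m * (m + 2 - h) := by
  rw [pochhammer, Finset.prod_range_succ', pochhammer]
  congr 1
  · exact Finset.prod_congr rfl fun j _ => by push_cast; ring
  · push_cast; ring

theorem add_two_sub_ne_zero (hh : ∀ j : ℕ, 2 ≤ j → h ≠ j) (m : ℕ) : (m + 2 - h : ℂ) ≠ 0 := by
  have := hh (m + 2) (by omega)
  push_cast at this
  exact sub_ne_zero.2 this.symm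

theorem pochhammer_shift_ne_zero (hh : ∀ j : ℕ, 2 ≤ j → h ≠ j) (m : ℕ) :
    pochhammer (m + 1 - h) m ≠ 0 := by
  induction m with
  | zero => simp [pochhammer]
  | succ m ih =>
    rw [pochhammer_shift_succ]
    exact mul_ne_zero ih (add_two_sub_ne_zero hh m)

theorem solutionCoeff_succ (hh : ∀ j : ℕ, 2 ≤ j → h ≠ j) (m : ℕ) :
    solutionCoeff h (m + 1) * ((m + 1) * (h - m - 2)) = solutionCoeff h m := by
  have h1 := pochhammer_shift_ne_zero hh m
  have h2 := add_two_sub_ne_zero hh m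
  have h3 : (m.factorial : ℂ) ≠ 0 := by exact_mod_cast m.factorial_ne_zero
  have h4 : (m + 1 : ℂ) ≠ 0 := by exact_mod_cast m.succ_ne_zero
  rw [solutionCoeff, solutionCoeff, pochhammer_shift_succ, Nat.factorial_succ]
  push_cast
  field_simp
  ring

theorem solutionCoeff_ne_zero (hh : ∀ j : ℕ, 2 ≤ j → h ≠ j) (m : ℕ) : solutionCoeff h m ≠ 0 :=
  div_ne_zero (pow_ne_zero _ (by norm_num))
    (mul_ne_zero (by exact_mod_cast m.factorial_ne_zero) (pochhammer_shift_ne_zero hh m))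

/-- By the recursion, successive terms have ratio `z / ((m+1)(h-m-2))`, which tends to 0. -/
theorem summable_solutionCoeff (hh : ∀ j : ℕ, 2 ≤ j → h ≠ j) {z : ℂ} (hz : z ≠ 0) :
    Summable fun m => solutionCoeff h m * z ^ m := by
  refine summable_of_ratio_test_tendsto_lt_one (l := 0) one_pos
    (Eventually.of_forall fun m => mul_ne_zero (solutionCoeff_ne_zero hh m) (pow_ne_zero _ hz)) ?_
  have e : ∀ m : ℕ, ‖solutionCoeff h (m + 1) * z ^ (m + 1)‖ / ‖solutionCoeff h m * z ^ m‖ =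
      ‖z‖ * (‖((m : ℂ) + 1)‖⁻¹ * ‖(m + 2 - h : ℂ)‖⁻¹) := by
    intro m
    have h1 := solutionCoeff_ne_zero hh (m + 1)
    have h2 := add_two_sub_ne_zero hh m
    have h4 : (m + 1 : ℂ) ≠ 0 := by exact_mod_cast m.succ_ne_zero
    rw [← solutionCoeff_succ hh m, ← norm_div, ← norm_inv, ← norm_inv, ← norm_mul, ← norm_mul,
      ← norm_neg]
    congr 1
    have h5 : (h - m - 2 : ℂ) ≠ 0 := by
      rw [← neg_ne_zero]
      convert h2 using 1
      ring
    rw [show (m + 2 - h : ℂ) = -(h - m - 2) by ring]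
    rw [pow_succ]
    field_simp
  simp only [e]
  have t : ∀ c : ℂ, Tendsto (fun m : ℕ => ‖((m : ℂ) + c)‖⁻¹) atTop (𝓝 0) := fun c =>
    tendsto_inv_atTop_zero.comp (tendsto_norm_cobounded_atTop.comp
      ((tendsto_add_const_cobounded c).comp (RCLike.tendsto_ofReal_atTop_cobounded ℂ |>.comp
        tendsto_natCast_atTop_atTop)))
  simpa [add_sub_assoc] using ((t 1).mul (t (2 - h))).const_mul ‖z‖

/-- Each step is the functional equation `Γ(s+1) = s Γ(s)` at `s = m+2-h`. -/
theorem Gamma_shift (hh : ∀ j : ℕ, 2 ≤ j → h ≠ j) (m : ℕ) :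
    Complex.Gamma (m + (1 - h) + 1) = Complex.Gamma (2 - h) * pochhammer (m + 1 - h) m := by
  induction m with
  | zero =>
    simp only [pochhammer, Finset.range_zero, Finset.prod_empty, mul_one, Nat.cast_zero]
    congr 1
    ring
  | succ m ih =>
    have e : ((m + 1 : ℕ) : ℂ) + (1 - h) + 1 = (m + 2 - h) + 1 := by push_cast; ring
    rw [e, Complex.Gamma_add_one _ (add_two_sub_ne_zero hh m), pochhammer_shift_succ, ← mul_assoc,
      ← ih, show (m + (1 - h) + 1 : ℂ) = m + 2 - h by ring, mul_comm]

theorem hasSum_solutionCoeff (hh : ∀ j : ℕ, 2 ≤ j → h ≠ j) {z : ℂ} (hz : z ≠ 0) :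
    HasSum (fun m => solutionCoeff h m * z ^ m)
      (z ^ ((h - 1) / 2) * Complex.Gamma (2 - h) * besselJ (1 - h) (2 * z ^ (1 / 2 : ℂ))) := by
  have hΓ : Complex.Gamma (2 - h) ≠ 0 := Complex.Gamma_ne_zero fun m hm => by
    apply add_two_sub_ne_zero hh m
    linear_combination hm
  have hsq : (z ^ (1 / 2 : ℂ)) ^ 2 = z := by
    rw [one_div]
    exact_mod_cast Complex.cpow_nat_inv_pow z two_ne_zero
  have hpow : z ^ ((h - 1) / 2) * (z ^ (1 / 2 : ℂ)) ^ (1 - h) = 1 := by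
    -- Halving the argument keeps it in the principal range, so `(z^{1/2})^{1-h} = z^{(1-h)/2}`
    -- holds without a branch correction.
    have him : (Complex.log z * (1 / 2 : ℂ)).im = Complex.arg z / 2 := by
      rw [show (1 / 2 : ℂ) = ((1 / 2 : ℝ) : ℂ) by norm_num, Complex.im_mul_ofReal, Complex.log_im]
      ring
    have hpi := Real.pi_pos
    rw [← Complex.cpow_mul, ← Complex.cpow_add _ _ hz,
      show (h - 1) / 2 + 1 / 2 * (1 - h) = 0 by ring, Complex.cpow_zero]
    · rw [him]; linarith [Complex.neg_pi_lt_arg z]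
    · rw [him]; linarith [Complex.arg_le_pi z]
  have hterm : ∀ m : ℕ, (-1) ^ m / ((m.factorial : ℂ) * Complex.Gamma (m + (1 - h) + 1)) *
      (z ^ (1 / 2 : ℂ)) ^ (2 * m) =
      (Complex.Gamma (2 - h))⁻¹ * (solutionCoeff h m * z ^ m) := by
    intro m
    have h1 := pochhammer_shift_ne_zero hh m
    have h3 : (m.factorial : ℂ) ≠ 0 := by exact_mod_cast m.factorial_ne_zero
    rw [Gamma_shift hh, pow_mul, hsq, solutionCoeff]
    field_simp
  have hval : z ^ ((h - 1) / 2) * Complex.Gamma (2 - h) *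
      besselJ (1 - h) (2 * z ^ (1 / 2 : ℂ)) = ∑' m, solutionCoeff h m * z ^ m := by
    rw [besselJ, mul_div_cancel_left₀ _ (two_ne_zero' ℂ)]
    simp only [hterm, tsum_mul_left]
    rw [mul_mul_mul_comm, hpow, one_mul, mul_inv_cancel_left₀ hΓ]
  rw [hval]
  exact (summable_solutionCoeff hh hz).hasSum

end Bessel

/-! ### From the manifold to charts -/

section Manifold

variable {d k : ℕ} {M : Type*} [TopologicalSpace M] [ChartedSpace (Coord d) M]
  {φ : OpenPartialHomeomorph M (Coord d)}

theorem PseudoMetric.isMetricOn_gram (g : PseudoMetric d M)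
    (hφ : φ ∈ IsManifold.maximalAtlas (𝓡 d) ∞ M) : IsMetricOn (gram g.form φ) φ.target where
  isOpen := φ.open_target
  smooth := g.smooth φ hφ
  isSymm x _ := by
    ext i j
    exact g.symm _ _ _
  det_ne_zero x hx := by
    intro hdet
    obtain ⟨v, hv, hAv⟩ := Matrix.exists_mulVec_eq_zero_iff.2 hdet
    have hdiff : φ.symm.MDifferentiable (𝓡 d) (𝓡 d) :=
      ⟨(contMDiffOn_symm_of_mem_maximalAtlas hφ).mdifferentiableOn (by simp),
        (contMDiffOn_of_mem_maximalAtlas hφ).mdifferentiableOn (by simp)⟩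
    have hbij := hdiff.mfderiv_bijective (x := x) hx
    set L : Coord d →L[ℝ] TangentSpace (𝓡 d) (φ.symm x) := mfderiv (𝓡 d) (𝓡 d) φ.symm x
    have hexp : ∀ u : Coord d, L u = ∑ i, u i • L (EuclideanSpace.single i 1) := by
      intro u
      conv_lhs => rw [← (EuclideanSpace.basisFun (Fin d) ℝ).sum_repr u, map_sum]
      simp
    -- A kernel vector of the Gram matrix is pushed forward by the bijective `L` to a vector
    -- orthogonal to the whole tangent space.
    have hzero : L (WithLp.toLp 2 v) = 0 := by
      refine g.nondegenerate _ _ fun W => ?_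
      obtain ⟨u : Coord d, rfl⟩ := hbij.2 W
      rw [g.symm]
      change g.form _ (L u) _ = 0
      rw [hexp u, hexp (WithLp.toLp 2 v)]
      simp only [map_sum, LinearMap.sum_apply, map_smul, LinearMap.smul_apply]
      simp only [Finset.smul_sum]
      rw [Finset.sum_comm]
      refine Finset.sum_eq_zero fun i _ => ?_
      have hi := congrFun hAv i
      simp only [Matrix.mulVec, dotProduct, gram, Matrix.of_apply, Pi.zero_apply] at hi
      rw [← mul_zero (u i), ← hi, Finset.mul_sum]
      exact Finset.sum_congr rfl fun j _ => by
        rw [smul_eq_mul, smul_eq_mul, mul_left_comm, mul_comm (v j)]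
        rfl
    have : (WithLp.toLp 2 v : Coord d) = 0 := hbij.1 (hzero.trans (map_zero L).symm)
    exact hv (by simpa using this)

theorem contDiffOn_comp_symm (hφ : φ ∈ IsManifold.maximalAtlas (𝓡 d) ∞ M) {u : M → ℝ}
    (hu : ContMDiff (𝓡 d) 𝓘(ℝ, ℝ) ∞ u) : ContDiffOn ℝ ∞ (fun x => u (φ.symm x)) φ.target :=
  contMDiffOn_iff_contDiffOn.1
    (hu.comp_contMDiffOn (contMDiffOn_symm_of_mem_maximalAtlas hφ))

theorem tensorPowerAct_smul (S : Matrix (TIdx d) (TIdx d) ℝ) (c : ℂ) (T : TTensor d k) :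
    tensorPowerAct S (c • T) = c • tensorPowerAct S T := by
  ext B
  simp only [tensorPowerAct, Pi.smul_apply, smul_eq_mul, Finset.mul_sum]
  exact Finset.sum_congr rfl fun _ _ => by ring

/-- The product of a smooth function and a section of a weighted tractor bundle. -/
def TractorSection.functionSMul {C : ConformalStructure d M} {Φ : TensorPart d k} {w : ℂ}
    (q : M → ℝ) (hq : ContMDiff (𝓡 d) 𝓘(ℝ, ℝ) ∞ q) (u : TractorSection C Φ w) :
    TractorSection C Φ w where
  comp g φ x := (q (φ.symm x) : ℂ) • u.comp g φ x
  smooth g hg φ hφ := (contDiffOn_ofReal (contDiffOn_comp_symm hφ hq)).smul (u.smooth g hg φ hφ)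
  mem g hg φ hφ x hx := (Φ.space _).smul_mem _ (u.mem g hg φ hφ x hx)
  transform g hg g' hg' Υ hΥ φ hφ ψ hψ p hp := by
    rw [φ.left_inv hp.1, ψ.left_inv hp.2, u.transform g hg g' hg' Υ hΥ φ hφ ψ hψ p hp,
      tensorPowerAct_smul, smul_comm]

end Manifold

end DegenerateLaplacian

end

/-! ### Assembly of the theorem -/

open DegenerateLaplacian in
theorem proposition5p3 {d k : ℕ} (hd : 3 ≤ d)
    {M : Type*} [TopologicalSpace M] [ChartedSpace (Coord d) M] [IsManifold (𝓡 d) ∞ M]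
    (C : ConformalStructure d M) (σ : RealScale C) (hI : ScaleSqNowhereZero σ)
    (Φ : TensorPart d k) (w₀ h₀ : ℂ) (hh₀ : h₀ = d + 2 * w₀)
    (hw₀ : ∀ j : ℤ, 2 ≤ j → w₀ ≠ ((j : ℂ) - d) / 2) :
    ∃ K : PowerSeries ℂ,
      -- `:K:` is a formal solution operator on `𝓔^Φ[w₀]`
      IsFormalSolutionOperator σ Φ w₀ K ∧
      -- it is the only one, as soon as `𝓔^Φ` does not vanish along the zero locus of `σ`
      ((∃ u : TractorSection C Φ w₀, u.NonzeroAlong σ) →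
        ∀ K' : PowerSeries ℂ, IsFormalSolutionOperator σ Φ w₀ K' → K' = K) ∧
      -- its terms are `σ^m (1 / (m! (m+1-h₀)_m)) ((1/I²) I·D)^m f₀`
      (∀ f₀ : TractorSection C Φ w₀, ∀ m : ℕ, ∀ g ∈ C.metrics,
        ∀ φ ∈ IsManifold.maximalAtlas (𝓡 d) ∞ M, ∀ x ∈ φ.target,
        (PowerSeries.coeff m K * (σ.inChart g φ x : ℂ) ^ m) •
            wpow (yOp (gram g.form φ) (σ.inChart g φ)) w₀ m (f₀.comp g φ) x
          = ((σ.inChart g φ x : ℂ) ^ m *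
              (1 / ((m.factorial : ℂ) * pochhammer (m + 1 - h₀) m))) •
            wpow (normIdotD (gram g.form φ) (σ.inChart g φ)) w₀ m (f₀.comp g φ) x) ∧
      -- when `I²` is constant, they are `σ^m (1 / (m! (m+1-h₀)_m (I²)^m)) (I·D)^m f₀`
      (∀ c : ℂ, (∀ g ∈ C.metrics, ∀ φ ∈ IsManifold.maximalAtlas (𝓡 d) ∞ M, ∀ x ∈ φ.target,
          scaleSq (gram g.form φ) (σ.inChart g φ) x = c) →
        ∀ f₀ : TractorSection C Φ w₀, ∀ m : ℕ, ∀ g ∈ C.metrics,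
        ∀ φ ∈ IsManifold.maximalAtlas (𝓡 d) ∞ M, ∀ x ∈ φ.target,
        (PowerSeries.coeff m K * (σ.inChart g φ x : ℂ) ^ m) •
            wpow (yOp (gram g.form φ) (σ.inChart g φ)) w₀ m (f₀.comp g φ) x
          = ((σ.inChart g φ x : ℂ) ^ m *
              (1 / ((m.factorial : ℂ) * pochhammer (m + 1 - h₀) m * c ^ m))) •
            wpow (IdotD (gram g.form φ) (σ.inChart g φ)) w₀ m (f₀.comp g φ) x) ∧
      -- the denominators do not vanish
      (∀ m : ℕ, pochhammer (m + 1 - h₀) m ≠ 0) ∧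
      -- `K(z) = ∑ (-z)^m / (m! (m+1-h₀)_m) = z^{(h₀-1)/2} Γ(2-h₀) J_{1-h₀}(2√z)`
      (∀ m : ℕ, PowerSeries.coeff m K =
        (-1) ^ m / ((m.factorial : ℂ) * pochhammer (m + 1 - h₀) m)) ∧
      (∀ z : ℂ, z ≠ 0 → HasSum (fun m : ℕ => PowerSeries.coeff m K * z ^ m)
        (z ^ ((h₀ - 1) / 2) * Complex.Gamma (2 - h₀) *
          besselJ (1 - h₀) (2 * z ^ (1 / 2 : ℂ)))) := by
  have hd0 : d ≠ 0 := by omega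
  have hh : ∀ j : ℕ, 2 ≤ j → h₀ ≠ j := by
    intro j hj hj'
    refine hw₀ j (by exact_mod_cast hj) ?_
    rw [hh₀] at hj'
    push_cast
    rw [← hj']
    ring
  have hw : ∀ j : ℕ, 2 ≤ j → (d + 2 * w₀ : ℂ) ≠ j := hh₀ ▸ hh
  have hG : ∀ g : PseudoMetric d M, ∀ φ ∈ IsManifold.maximalAtlas (𝓡 d) ∞ M,
      IsMetricOn (gram g.form φ) φ.target := fun g φ hφ => g.isMetricOn_gram hφ
  have hs : ∀ g ∈ C.metrics, ∀ φ ∈ IsManifold.maximalAtlas (𝓡 d) ∞ M,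
      ContDiffOn ℝ ∞ (σ.inChart g φ) φ.target := fun g hg φ hφ =>
    contDiffOn_comp_symm hφ (σ.smooth g hg)
  have hK : ∀ m : ℕ, PowerSeries.coeff m (PowerSeries.mk (solutionCoeff h₀)) =
      solutionCoeff h₀ m := fun m => PowerSeries.coeff_mk m _
  refine ⟨PowerSeries.mk (solutionCoeff h₀), ⟨?_, ?_⟩, ?_, ?_, ?_, pochhammer_shift_ne_zero hh,
    hK, fun z hz => by simpa only [hK] using hasSum_solutionCoeff hh hz⟩
  · rw [← PowerSeries.coeff_zero_eq_constantCoeff_apply, hK]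
    simp [solutionCoeff, pochhammer]
  · intro f₀ ℓ g hg φ hφ
    have hf := f₀.smooth g hg φ hφ
    have hy := (hG g φ hφ).contDiffOn_wpow_yOp (w := w₀) (hs g hg φ hφ) (hI g hg φ hφ) hf ℓ
    refine ⟨fun x => solutionCoeff h₀ ℓ • IdotD (gram g.form φ) (σ.inChart g φ) (w₀ - ℓ)
      (wpow (yOp (gram g.form φ) (σ.inChart g φ)) w₀ ℓ (f₀.comp g φ)) x,
      ((hG g φ hφ).contDiffOn_IdotD (hs g hg φ hφ) hy).const_smul _, fun x hx => ?_⟩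
    rw [(hG g φ hφ).IdotD_normalOrdered hd0 (hs g hg φ hφ) (hI g hg φ hφ) hf _ ℓ _ hx, hK,
      mul_comm, mul_smul]
    intro m _
    rw [hK, hK, ← hh₀]
    exact solutionCoeff_succ hh m
  · rintro ⟨u, g, hg, φ, hφ, p, hp, hp0, hup⟩ K' ⟨hK0, hK'⟩
    have hrec := (hG g φ hφ).coeff_recursion hd0 (hs g hg φ hφ) (hI g hg φ hφ) hw K'
      (u.smooth g hg φ hφ) (φ.map_source hp)
      (by simpa only [RealScale.inChart, φ.left_inv hp] using hp0) hup (fun n => by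
        -- In the fixed metric `g` the representative of `σ` is a function on `M`, so multiplying
        -- `u` by its `n`-th power keeps the weight `w₀` and gives an admissible test section.
        obtain ⟨r, hr, hrx⟩ := hK' (u.functionSMul (fun q => σ.val g q ^ n)
          ((σ.smooth g hg).pow n)) n g hg φ hφ
        refine ⟨r, hr, fun x hx => ?_⟩
        have hx' := hrx x hx
        simp only [TractorSection.functionSMul, Complex.ofReal_pow] at hx'
        exact hx')
    ext m
    induction m with
    | zero =>
      rw [PowerSeries.coeff_zero_eq_constantCoeff_apply, hK0, hK]
      simp [solutionCoeff, pochhammer]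
    | succ m ih =>
      have h1 := hrec m
      rw [ih, hK, ← solutionCoeff_succ hh m, ← hh₀] at h1
      rw [hK]
      refine mul_right_cancel₀ (mul_ne_zero (by exact_mod_cast m.succ_ne_zero) ?_) h1
      rw [show h₀ - m - 2 = -(m + 2 - h₀) by ring]
      exact neg_ne_zero.2 (add_two_sub_ne_zero hh m)
  · intro f₀ m g hg φ hφ x hx
    rw [(hG g φ hφ).wpow_eq_smul_wpow_yOp (hs g hg φ hφ) (hI g hg φ hφ) (b := -1)
      (P := normIdotD (gram g.form φ) (σ.inChart g φ))
      (fun w f x _ => by simp only [normIdotD, yOp, smul_smul, neg_mul, one_mul, neg_neg])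
      (f₀.smooth g hg φ hφ) m hx, hK, smul_smul, solutionCoeff]
    congr 1
    ring
  · intro c hc f₀ m g hg φ hφ x hx
    have hc0 : c ≠ 0 := hc g hg φ hφ x hx ▸ hI g hg φ hφ x hx
    rw [(hG g φ hφ).wpow_eq_smul_wpow_yOp (hs g hg φ hφ) (hI g hg φ hφ) (b := -c)
      (P := IdotD (gram g.form φ) (σ.inChart g φ))
      (fun w f x hx => by
        rw [yOp, hc g hg φ hφ x hx, smul_smul, neg_mul_neg, mul_one_div_cancel hc0, one_smul])
      (f₀.smooth g hg φ hφ) m hx, hK, smul_smul, solutionCoeff, neg_pow c]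
    congr 1
    have h1 := pochhammer_shift_ne_zero hh m
    have h3 : (m.factorial : ℂ) ≠ 0 := by exact_mod_cast m.factorial_ne_zero
    field_simp
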